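/- Fix natural numbers $N$ and $n$. A differential field is a field $K$ with $N$ commuting derivations $\partial_1,\dots,\partial_N$; a differential field extension of $K$ is a field extension $L$ of $K$ with $N$ commuting derivations extending those of $K$. The differential polynomial ring $K\{x_1,\dots,x_n\}$ is the polynomial ring over $K$ in the independent variables $\theta x_i$, where $1\le i\le n$ and $\theta=\partial_1^{e_1}\cdots\partial_N^{e_N}$ with $e_1,\dots,e_N\in\mathbb{N}$, made into a ring with $N$ commuting derivations by letting each $\partial_j$ extend the given derivation of $K$ and send $\theta x_i$ to $(\partial_j\theta)x_i$. The value $p(a)$ of $p\in K\{x_1,\dots,x_n\}$ at a tuple $a=(a_1,\dots,a_n)$ of elements of a differential field extension is obtained by substituting $\theta(a_i)$ for $\theta x_i$. An ideal $\mathcal{I}$ of $K\{x_1,\dots,x_n\}$ is a differential ideal if $\partial_j f\in\mathcal{I}$ for all $f\in\mathcal{I}$ and all $j\le N$. A differential field $K$ is differentially closed if, for every $m$ and all finite sets $P,Q\subseteq K\{x_1,\dots,x_m\}$, whenever some differential field extension $L$ of $K$ contains a tuple $a\in L^m$ with $p(a)=0$ for all $p\in P$ and $q(a)\ne0$ for all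 $q\in Q$, there is already such a tuple in $K^m$. Corollary (Differential Nullstellensatz). Let $K$ be a differentially closed field of characteristic $0$ and let $\mathcal{I}$ be a proper differential ideal of $K\{x_1,\dots,x_n\}$. Then $\mathcal{I}$ has a zero in $K^n$: there is $a\in K^n$ such that $f(a)=0$ for all $f\in\mathcal{I}$. -/

import Mathlib

universe u v

/-- A commutative ring with `N` commuting derivations `∂_0, …, ∂_{N-1}`. -/
class DifferentialRing (N : ℕ) (R : Type u) [CommRing R] where
  /-- The derivations. -/
  der : Fin N → Derivation ℤ R R
  /-- The derivations commute with each other. -/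
  der_comm : ∀ (i j : Fin N) (a : R), der i (der j a) = der j (der i a)

namespace DifferentialRing

/-- The operator `θ = ∂_0 ^ e_0 ⋯ ∂_{N-1} ^ e_{N-1}` applied to `a`. -/
def theta {N : ℕ} {R : Type u} [CommRing R] [DifferentialRing N R] (e : Fin N → ℕ) (a : R) : R :=
  (List.ofFn fun j : Fin N => ((der j : Derivation ℤ R R) : Module.End ℤ R) ^ e j).prod a

/-- `D` applied to the coefficients of a polynomial, as an additive map. -/
noncomputable def coeffMap {R : Type u} [CommRing R] (σ : Type v) (D : Derivation ℤ R R) :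
    MvPolynomial σ R →+ MvPolynomial σ R where
  toFun f := Finsupp.sum (AddMonoidAlgebra.coeff f) fun s a => MvPolynomial.monomial s (D a)
  map_zero' := by simp
  map_add' f g := by
    rw [AddMonoidAlgebra.coeff_add]
    exact Finsupp.sum_add_index' (by simp) (by simp)

theorem coeffMap_monomial {R : Type u} [CommRing R] {σ : Type v} (D : Derivation ℤ R R)
    (s : σ →₀ ℕ) (a : R) :
    coeffMap σ D (MvPolynomial.monomial s a) = MvPolynomial.monomial s (D a) := by
  change Finsupp.sum (AddMonoidAlgebra.coeff (MvPolynomial.monomial s a))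
    (fun s a => MvPolynomial.monomial s (D a)) = _
  rw [MvPolynomial.sum_monomial_eq (by simp)]

theorem coeffMap_mul {R : Type u} [CommRing R] {σ : Type v} (D : Derivation ℤ R R)
    (f g : MvPolynomial σ R) :
    coeffMap σ D (f * g) = f * coeffMap σ D g + g * coeffMap σ D f := by
  induction f using MvPolynomial.induction_on' with
  | add p q hp hq => rw [add_mul, map_add, map_add, hp, hq]; ring
  | monomial s a =>
    induction g using MvPolynomial.induction_on' with
    | add p q hp hq => rw [mul_add, map_add, map_add, hp, hq]; ring
    | monomial t b =>
      simp only [MvPolynomial.monomial_mul, coeffMap_monomial, Derivation.leibniz, smul_eq_mul,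
        map_add, add_comm t s]

/-- The derivation of `R[σ]` that applies the derivation `D` of `R` to the coefficients and
sends the variable `x` to the polynomial `h x`. -/
noncomputable def polyDer {R : Type u} [CommRing R] {σ : Type v} (D : Derivation ℤ R R)
    (h : σ → MvPolynomial σ R) : Derivation ℤ (MvPolynomial σ R) (MvPolynomial σ R) :=
  Derivation.mk' (coeffMap σ D).toIntLinearMap (coeffMap_mul D) +
    (MvPolynomial.mkDerivation R h).restrictScalars ℤ

theorem polyDer_C {R : Type u} [CommRing R] {σ : Type v} (D : Derivation ℤ R R)
    (h : σ → MvPolynomial σ R) (a : R) :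
    polyDer D h (MvPolynomial.C a) = MvPolynomial.C (D a) := by
  have h1 : polyDer D h (MvPolynomial.C a) = coeffMap σ D (MvPolynomial.monomial 0 a) +
    MvPolynomial.mkDerivation R h (MvPolynomial.C a) := rfl
  rw [h1, coeffMap_monomial, MvPolynomial.derivation_C, add_zero]
  rfl

theorem polyDer_X {R : Type u} [CommRing R] {σ : Type v} (D : Derivation ℤ R R)
    (h : σ → MvPolynomial σ R) (x : σ) :
    polyDer D h (MvPolynomial.X x) = h x := by
  have h1 : polyDer D h (MvPolynomial.X x) =
    coeffMap σ D (MvPolynomial.monomial (Finsupp.single x 1) 1) +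
    MvPolynomial.mkDerivation R h (MvPolynomial.X x) := rfl
  rw [h1, coeffMap_monomial, MvPolynomial.mkDerivation_X, Derivation.map_one_eq_zero, map_zero,
    zero_add]

end DifferentialRing

/-- The differential polynomial ring `R{x_1, …, x_n}` for `N` derivations: the polynomial ring
over `R` in the variables `θ x_i`, where `(i, e)` stands for `∂^e x_i`. -/
abbrev DiffPoly (N n : ℕ) (R : Type u) [CommRing R] : Type u :=
  MvPolynomial (Fin n × (Fin N → ℕ)) R

namespace DiffPoly

open DifferentialRing

/-- The `j`-th derivation of `R{x_1, …, x_n}`: it extends the `j`-th derivation of `R` and sends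
`∂^e x_i` to `∂_j ∂^e x_i`. -/
noncomputable def polyDeriv {N n : ℕ} {R : Type u} [CommRing R] [DifferentialRing N R]
    (j : Fin N) : Derivation ℤ (DiffPoly N n R) (DiffPoly N n R) :=
  polyDer (der j) fun x => MvPolynomial.X (x.1, x.2 + Pi.single j 1)

theorem polyDeriv_comm {N n : ℕ} {R : Type u} [CommRing R] [DifferentialRing N R]
    (i j : Fin N) (f : DiffPoly N n R) :
    polyDeriv i (polyDeriv j f) = polyDeriv j (polyDeriv i f) := by
  induction f using MvPolynomial.induction_on with
  | C a => simp only [polyDeriv, polyDer_C, der_comm i j a]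
  | add p q hp hq => simp only [map_add, hp, hq]
  | mul_X p x hp =>
    have hx : polyDeriv i (polyDeriv j (MvPolynomial.X x : DiffPoly N n R)) =
        polyDeriv j (polyDeriv i (MvPolynomial.X x)) := by
      simp only [polyDeriv, polyDer_X, add_right_comm]
    simp only [Derivation.leibniz, map_add, smul_eq_mul, hp, hx]
    ring

noncomputable instance {N n : ℕ} {R : Type u} [CommRing R] [DifferentialRing N R] :
    DifferentialRing N (DiffPoly N n R) where
  der := polyDeriv
  der_comm := polyDeriv_comm

/-- The value `p(a)` of a differential polynomial `p` over `R` at a tuple `a` of elements of a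
differential `R`-algebra `S`: the variable `θ x_i` is replaced by `θ(a_i)`. -/
noncomputable def eval {N n : ℕ} {R : Type u} {S : Type v} [CommRing R] [CommRing S] [Algebra R S]
    [DifferentialRing N S] (a : Fin n → S) (p : DiffPoly N n R) : S :=
  MvPolynomial.aeval (fun x : Fin n × (Fin N → ℕ) => theta x.2 (a x.1)) p

end DiffPoly

/-- An ideal is a differential ideal if it is closed under all the derivations. -/
def IsDifferentialIdeal (N : ℕ) {R : Type u} [CommRing R] [DifferentialRing N R]
    (I : Ideal R) : Prop :=
  ∀ (j : Fin N), ∀ f ∈ I, DifferentialRing.der j f ∈ I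

/-- The derivations of the differential ring `S` extend those of `R`. -/
def IsDifferentialExtension (N : ℕ) (R : Type u) (S : Type v) [CommRing R] [CommRing S]
    [Algebra R S] [DifferentialRing N R] [DifferentialRing N S] : Prop :=
  ∀ (j : Fin N) (a : R),
    DifferentialRing.der j (algebraMap R S a) = algebraMap R S (DifferentialRing.der j a)

/-- A differential field `K` is differentially closed if every finite system of differential
polynomial equations and inequations over `K` that has a solution in some differential field
extension `L` of `K` has a solution in `K`. For infinite `K` (in particular, in characteristic
zero), it makes no difference that `L` ranges over the universe of `K`: a solution generates a
differential field extension of the same cardinality as `K`. -/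
def IsDifferentiallyClosed (N : ℕ) (K : Type u) [Field K] [DifferentialRing N K] : Prop :=
  ∀ (m : ℕ) (P Q : Finset (DiffPoly N m K)),
    (∃ (L : Type u) (_ : Field L) (_ : Algebra K L) (_ : DifferentialRing N L),
      IsDifferentialExtension N K L ∧
        ∃ a : Fin m → L, (∀ p ∈ P, DiffPoly.eval a p = 0) ∧ ∀ q ∈ Q, DiffPoly.eval a q ≠ 0) →
    ∃ a : Fin m → K, (∀ p ∈ P, DiffPoly.eval a p = 0) ∧ ∀ q ∈ Q, DiffPoly.eval a q ≠ 0

/-! Zorn's lemma puts `I` inside a prime differential ideal `P`, and the fraction field of the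
quotient by `P` contains a generic zero of `P`. Differential closedness transfers only finite
systems to `K`, so `P` has to be pinned down by finite data: `exists_finset_characteristic` gives
finite `A ⊆ P` and `H` disjoint from `P` such that every prime differential ideal containing `A` and
avoiding `H` contains `P`. A point `b` of `K^n` with `A = 0` and `H ≠ 0` then exists, and its
vanishing ideal is such an ideal, so `b` is a zero of `P`.

The finite data come from characteristic sets. For each variable `v`, choose in `P` a polynomial in
`v` over the lower variables, of least degree among those with initial outside `P`. By Dickson's
lemma finitely many of these have leaders from which all the others arise by derivation; `A`
consists of these polynomials, `H` of their initials and separants. Pseudo-division by them and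
their derivatives, by induction on rank, does the rest. -/

/-! ### Radical and prime differential ideals. -/

open DifferentialRing in
/-- In a `ℚ`-algebra, `f ^ n ∈ M` forces a power of `∂ f` into the differential ideal `M`. -/
theorem IsDifferentialIdeal.pow_mul_der_pow_mem {N : ℕ} {R : Type u} [CommRing R] [Algebra ℚ R]
    [DifferentialRing N R] {M : Ideal R} (hM : IsDifferentialIdeal N M) (j : Fin N) (f : R)
    (n : ℕ) (m : ℕ) (h : f ^ (n + 1) * der j f ^ m ∈ M) :
    f ^ n * der j f ^ (m + 2) ∈ M := by
  -- With `f' = ∂ f`, the product `f' * (f^(n+1) f'^m)'` equals `(n+1) f^n f'^(m+2) + m f'' f^(n+1)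
  -- f'^m`. The extra factor `f'` makes the last term a multiple of the hypothesis.
  have h1 := M.mul_mem_left (der j f) (hM j _ h)
  rw [Derivation.leibniz, Derivation.leibniz_pow, Derivation.leibniz_pow] at h1
  simp only [smul_eq_mul, nsmul_eq_mul, Nat.add_sub_cancel] at h1
  have h2 : (m : R) * der j (der j f) * (f ^ (n + 1) * der j f ^ m) ∈ M :=
    M.mul_mem_left _ h
  have h3 : ((n + 1 : ℕ) : R) * (f ^ n * der j f ^ (m + 2)) ∈ M := by
    have h4 := M.sub_mem h1 h2
    convert h4 using 1
    cases m with
    | zero => simp; ring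
    | succ m => simp only [Nat.add_sub_cancel]; ring
  have h5 := M.mul_mem_left (algebraMap ℚ R ((n + 1 : ℕ) : ℚ)⁻¹) h3
  have h6 : algebraMap ℚ R ((n + 1 : ℕ) : ℚ)⁻¹ * ((n + 1 : ℕ) : R) = 1 := by
    rw [← map_natCast (algebraMap ℚ R), ← map_mul,
      inv_mul_cancel₀ (Nat.cast_ne_zero.2 n.succ_ne_zero), map_one]
  rwa [← mul_assoc, h6, one_mul] at h5

/-- Each use of `pow_mul_der_pow_mem` trades one factor `f` for two factors `∂ f`, so `f ^ n ∈ M`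
ends in `(∂ f) ^ (2 * n) ∈ M`. -/
theorem IsDifferentialIdeal.radical {N : ℕ} {R : Type u} [CommRing R] [Algebra ℚ R]
    [DifferentialRing N R] {M : Ideal R} (hM : IsDifferentialIdeal N M) :
    IsDifferentialIdeal N M.radical := by
  rintro j f ⟨n, hn⟩
  have key : ∀ k m : ℕ, f ^ k * DifferentialRing.der j f ^ m ∈ M →
      DifferentialRing.der j f ^ (m + 2 * k) ∈ M := by
    intro k
    induction k with
    | zero => intro m h; simpa using h
    | succ k ih =>
      intro m h
      have := ih _ (hM.pow_mul_der_pow_mem j f k m h)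
      rwa [show m + 2 + 2 * k = m + 2 * (k + 1) by ring] at this
  exact ⟨0 + 2 * n, key n 0 (by simpa using hn)⟩

/-- Every proper differential ideal of a differential `ℚ`-algebra is contained in a prime
differential ideal. -/
theorem IsDifferentialIdeal.exists_le_isPrime {N : ℕ} {R : Type u} [CommRing R] [Algebra ℚ R]
    [DifferentialRing N R] {I : Ideal R} (hI : IsDifferentialIdeal N I) (hne : I ≠ ⊤) :
    ∃ P : Ideal R, I ≤ P ∧ P.IsPrime ∧ IsDifferentialIdeal N P := by
  obtain ⟨M, hIM, hMmax⟩ := zorn_le_nonempty₀ {J : Ideal R | IsDifferentialIdeal N J ∧ J ≠ ⊤} (by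
    intro c hc hchain y hy
    refine ⟨sSup c, ⟨?_, ?_⟩, fun z hz => le_sSup hz⟩
    · intro j f hf
      obtain ⟨J, hJ, hfJ⟩ := (Submodule.mem_sSup_of_directed ⟨y, hy⟩ hchain.directedOn).1 hf
      exact (le_sSup hJ : J ≤ sSup c) ((hc hJ).1 j f hfJ)
    · rw [Ne, Ideal.eq_top_iff_one, Submodule.mem_sSup_of_directed ⟨y, hy⟩ hchain.directedOn]
      rintro ⟨J, hJ, h1⟩
      exact (hc hJ).2 ((Ideal.eq_top_iff_one J).2 h1)) I ⟨hI, hne⟩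
  obtain ⟨hMd, hMne⟩ := hMmax.prop
  have hrad : M.radical ≤ M :=
    hMmax.le_of_ge ⟨hMd.radical, by rwa [Ne, Ideal.radical_eq_top]⟩ Ideal.le_radical
  refine ⟨M, hIM, ⟨hMne, fun {a b} hab => ?_⟩, hMd⟩
  by_contra! hcon
  -- If `f a ∈ M`, then `f' a (f a)' - f' a' (f a) = (f' a)^2` lies in `M`, which is radical by
  -- maximality.
  have hcolon : IsDifferentialIdeal N (M.colon {a}) := by
    intro j f hf
    rw [Submodule.mem_colon_singleton, smul_eq_mul] at hf ⊢
    have h1 := M.mul_mem_left (DifferentialRing.der j f * a) (hMd j _ hf)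
    rw [Derivation.leibniz, smul_eq_mul, smul_eq_mul] at h1
    have h2 := M.sub_mem h1 (M.mul_mem_left
      (DifferentialRing.der j f * DifferentialRing.der j a) hf)
    refine hrad ⟨2, ?_⟩
    convert h2 using 1
    ring
  have hle : M.colon {a} ≤ M := by
    refine hMmax.le_of_ge ⟨hcolon, ?_⟩ ?_
    · rw [Ne, Ideal.eq_top_iff_one, Submodule.mem_colon_singleton, one_smul]
      exact hcon.1
    · intro x hx
      rw [Submodule.mem_colon_singleton]
      exact M.mul_mem_right _ hx
  exact hcon.2 (hle (by rwa [Submodule.mem_colon_singleton, smul_eq_mul, mul_comm]))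

/-! ### Derivations on the residue field of a prime differential ideal. -/

/-- A derivation that stabilizes the kernel of a ring homomorphism to a field `L`, whose image
generates `L` as a field, descends to `L`. -/
theorem Derivation.exists_descend {R : Type u} {L : Type v} [CommRing R] [Field L] {P : Ideal R}
    [P.IsPrime] [Algebra (R ⧸ P) L] [IsFractionRing (R ⧸ P) L] (D : Derivation ℤ R R)
    (hD : ∀ f ∈ P, D f ∈ P) :
    ∃ D' : Derivation ℤ L L, ∀ f : R, D' (algebraMap (R ⧸ P) L (Ideal.Quotient.mk P f)) =
      algebraMap (R ⧸ P) L (Ideal.Quotient.mk P (D f)) := by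
  let φ : R →+* L := (algebraMap (R ⧸ P) L).comp (Ideal.Quotient.mk P)
  -- A derivation `D'` of `L` amounts to a ring homomorphism `x ↦ x + ε D' x` into the dual numbers,
  -- so the universal properties of quotient and localization construct it.
  let ψ₀ : R →+* TrivSqZeroExt L L :=
    { toFun := fun f => TrivSqZeroExt.inl (φ f) + TrivSqZeroExt.inr (φ (D f))
      map_one' := by simp
      map_zero' := by simp
      map_add' := fun f g => by ext <;> simp
      map_mul' := fun f g => by ext <;> simp [mul_comm] }
  have hfst₀ : ∀ f, (ψ₀ f).fst = φ f := fun f => by simp [ψ₀]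
  have hsnd₀ : ∀ f, (ψ₀ f).snd = φ (D f) := fun f => by simp [ψ₀]
  have hψ₀ : ∀ f ∈ P, ψ₀ f = 0 := fun f hf => by
    have h0 : ∀ f ∈ P, φ f = 0 := fun f hf => by
      simp [φ, Ideal.Quotient.eq_zero_iff_mem.2 hf]
    ext
    · exact (hfst₀ f).trans (h0 f hf)
    · exact (hsnd₀ f).trans (h0 _ (hD f hf))
  let ψ₁ : R ⧸ P →+* TrivSqZeroExt L L := Ideal.Quotient.lift P ψ₀ hψ₀
  have hψ₁ : ∀ y : nonZeroDivisors (R ⧸ P), IsUnit (ψ₁ y) := by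
    rintro ⟨y, hy⟩
    obtain ⟨f, rfl⟩ := Ideal.Quotient.mk_surjective y
    rw [TrivSqZeroExt.isUnit_iff_isUnit_fst]
    change IsUnit (ψ₀ f).fst
    rw [hfst₀]
    exact (IsFractionRing.to_map_ne_zero_of_mem_nonZeroDivisors hy).isUnit
  let ψ : L →+* TrivSqZeroExt L L := IsLocalization.lift hψ₁
  have hψ : ∀ f, ψ (φ f) = ψ₀ f := fun f => by
    change IsLocalization.lift hψ₁ (algebraMap (R ⧸ P) L (Ideal.Quotient.mk P f)) = _
    rw [IsLocalization.lift_eq]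
    rfl
  have hfst : ∀ x, (ψ x).fst = x := by
    have : (TrivSqZeroExt.fstHom ℤ L L : TrivSqZeroExt L L →+* L).comp ψ = RingHom.id L := by
      refine IsLocalization.ringHom_ext (nonZeroDivisors (R ⧸ P)) ?_
      refine Ideal.Quotient.ringHom_ext ?_
      ext f
      exact (congrArg TrivSqZeroExt.fst (hψ f)).trans (hfst₀ f)
    exact fun x => RingHom.congr_fun this x
  refine ⟨Derivation.mk' (AddMonoidHom.toIntLinearMap
    { toFun := fun x => (ψ x).snd
      map_zero' := by simp
      map_add' := fun x y => by simp }) fun x y => ?_, fun f => ?_⟩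
  · change (ψ (x * y)).snd = x • (ψ y).snd + y • (ψ x).snd
    rw [map_mul, TrivSqZeroExt.snd_mul, hfst, hfst, op_smul_eq_smul]
  · exact (congrArg TrivSqZeroExt.snd (hψ f)).trans (hsnd₀ f)

/-- Applied to commutators: the descended derivations need only commute on the image of `R`. -/
theorem Derivation.eq_zero_of_isFractionRing {A : Type u} {L : Type v} [CommRing A] [IsDomain A]
    [Field L] [Algebra A L] [IsFractionRing A L] (D : Derivation ℤ L L)
    (hD : ∀ a : A, D (algebraMap A L a) = 0) : D = 0 := by
  ext x
  obtain ⟨a, b, hb, rfl⟩ := IsFractionRing.div_surjective (A := A) x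
  simp [hD, Derivation.leibniz_div]

/-- The fraction field of the quotient by a prime differential ideal is a differential field. -/
theorem IsDifferentialIdeal.exists_differentialRing {N : ℕ} {R : Type u} {L : Type v} [CommRing R]
    [DifferentialRing N R] [Field L] {P : Ideal R} [P.IsPrime] (hP : IsDifferentialIdeal N P)
    [Algebra (R ⧸ P) L] [IsFractionRing (R ⧸ P) L] :
    ∃ _ : DifferentialRing N L, ∀ (j : Fin N) (f : R),
      DifferentialRing.der j (algebraMap (R ⧸ P) L (Ideal.Quotient.mk P f)) =
      algebraMap (R ⧸ P) L (Ideal.Quotient.mk P (DifferentialRing.der j f)) := by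
  choose D hD using fun j : Fin N =>
    Derivation.exists_descend (L := L) (P := P) (DifferentialRing.der j) (hP j)
  refine ⟨⟨D, fun i j a => ?_⟩, hD⟩
  have h0 : ⁅D i, D j⁆ = 0 := by
    refine Derivation.eq_zero_of_isFractionRing (A := R ⧸ P) _ fun a => ?_
    obtain ⟨f, rfl⟩ := Ideal.Quotient.mk_surjective a
    rw [Derivation.commutator_apply, hD, hD, hD, hD, DifferentialRing.der_comm, sub_self]
  have h1 := congrArg (fun d : Derivation ℤ L L => d a) h0
  simpa [Derivation.commutator_apply, sub_eq_zero] using h1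

/-! ### The operators `theta`, evaluation and generic zeros. -/

theorem Pi.induction_add_single {N : ℕ} {p : (Fin N → ℕ) → Prop} (zero : p 0)
    (add_single : ∀ e j, p e → p (e + Pi.single j 1)) (e : Fin N → ℕ) : p e := by
  generalize hs : ∑ j, e j = s
  induction s generalizing e with
  | zero =>
    have : e = 0 := by
      ext j
      exact (Finset.sum_eq_zero_iff.1 hs) j (Finset.mem_univ j)
    rwa [this]
  | succ s ih =>
    obtain ⟨j, -, hj⟩ := Finset.exists_ne_zero_of_sum_ne_zero (hs.trans_ne s.succ_ne_zero)
    have hle : Pi.single j 1 ≤ e := by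
      intro k
      by_cases hk : k = j
      · subst hk; simpa using Nat.one_le_iff_ne_zero.2 hj
      · simp [hk]
    rw [← tsub_add_cancel_of_le hle] at hs ⊢
    refine add_single _ _ (ih _ ?_)
    simp only [Pi.add_apply, Finset.sum_add_distrib, Finset.sum_pi_single', Finset.mem_univ,
      if_true] at hs ⊢
    simp at hs
    simpa using hs

namespace DifferentialRing

theorem theta_zero {N : ℕ} {R : Type u} [CommRing R] [DifferentialRing N R] (a : R) :
    theta (0 : Fin N → ℕ) a = a := by
  simp [theta, List.prod_eq_one]

theorem theta_add_single {N : ℕ} {R : Type u} [CommRing R] [DifferentialRing N R]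
    (e : Fin N → ℕ) (j : Fin N) (a : R) :
    theta (e + Pi.single j 1) a = der j (theta e a) := by
  let D : Fin N → Module.End ℤ R := fun j => (der j : Derivation ℤ R R)
  have hcomm : ∀ i j, Commute (D i) (D j) := fun i j => LinearMap.ext (der_comm i j)
  -- The list has no duplicates, so exactly one factor gains an exponent, and the new `D j` commutes
  -- past those before it.
  have key : ∀ l : List (Fin N), l.Nodup → j ∈ l →
      (l.map fun k => D k ^ (e + Pi.single j 1 : Fin N → ℕ) k).prod =
        D j * (l.map fun k => D k ^ e k).prod := by
    intro l
    induction l with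
    | nil => simp
    | cons k l ih =>
      intro hl hj
      rw [List.nodup_cons] at hl
      rw [List.map_cons, List.map_cons, List.prod_cons, List.prod_cons]
      by_cases hkj : k = j
      · subst hkj
        have hrest : (l.map fun i => D i ^ (e + Pi.single k 1 : Fin N → ℕ) i) = l.map fun i => D i ^ e i := by
          refine List.map_congr_left fun i hi => ?_
          have : i ≠ k := fun h => hl.1 (h ▸ hi)
          simp [this]
        rw [hrest, Pi.add_apply, Pi.single_eq_same, pow_succ', mul_assoc]
      · have hjl : j ∈ l := by simpa [Ne.symm hkj] using hj
        rw [ih hl.2 hjl, Pi.add_apply, Pi.single_eq_of_ne hkj, add_zero, ← mul_assoc, ← mul_assoc,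
          ((hcomm j k).pow_right (e k)).eq]
  have := key (List.finRange N) (List.nodup_finRange N) (List.mem_finRange j)
  rw [← List.ofFn_eq_map, ← List.ofFn_eq_map] at this
  exact LinearMap.congr_fun this a

end DifferentialRing

namespace DiffPoly

open DifferentialRing

theorem der_C {N n : ℕ} {R : Type u} [CommRing R] [DifferentialRing N R] (j : Fin N) (a : R) :
    der j (MvPolynomial.C a : DiffPoly N n R) = MvPolynomial.C (der j a) :=
  polyDer_C _ _ _

theorem der_X {N n : ℕ} {R : Type u} [CommRing R] [DifferentialRing N R] (j : Fin N)
    (x : Fin n × (Fin N → ℕ)) :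
    der j (MvPolynomial.X x : DiffPoly N n R) = MvPolynomial.X (x.1, x.2 + Pi.single j 1) :=
  polyDer_X _ _ _

theorem eval_der {N n : ℕ} {R : Type u} {S : Type v} [CommRing R] [CommRing S] [Algebra R S]
    [DifferentialRing N R] [DifferentialRing N S] (hS : IsDifferentialExtension N R S)
    (a : Fin n → S) (j : Fin N) (f : DiffPoly N n R) :
    eval a (der j f) = der j (eval a f) := by
  induction f using MvPolynomial.induction_on with
  | C c => simp [der_C, eval, hS j c]
  | add p q hp hq =>
    simp only [eval, map_add] at hp hq ⊢
    rw [hp, hq]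
  | mul_X p x hp =>
    simp only [eval, Derivation.leibniz, smul_eq_mul, map_add, map_mul, der_X,
      MvPolynomial.aeval_X, theta_add_single] at hp ⊢
    rw [hp]

/-- The kernel of the evaluation at a tuple. -/
noncomputable def vanishingIdeal {N n : ℕ} {R : Type u} {S : Type v} [CommRing R] [CommRing S]
    [Algebra R S] [DifferentialRing N S] (a : Fin n → S) : Ideal (DiffPoly N n R) :=
  RingHom.ker (MvPolynomial.aeval (R := R) fun x : Fin n × (Fin N → ℕ) => theta x.2 (a x.1))

theorem mem_vanishingIdeal {N n : ℕ} {R : Type u} {S : Type v} [CommRing R] [CommRing S]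
    [Algebra R S] [DifferentialRing N S] {a : Fin n → S} {f : DiffPoly N n R} :
    f ∈ vanishingIdeal a ↔ eval a f = 0 :=
  RingHom.mem_ker

theorem vanishingIdeal_isPrime {N n : ℕ} {R : Type u} {S : Type v} [CommRing R] [CommRing S]
    [IsDomain S] [Algebra R S] [DifferentialRing N S] (a : Fin n → S) :
    (vanishingIdeal a : Ideal (DiffPoly N n R)).IsPrime :=
  RingHom.ker_isPrime _

theorem isDifferentialIdeal_vanishingIdeal {N n : ℕ} {R : Type u} {S : Type v} [CommRing R]
    [CommRing S] [Algebra R S] [DifferentialRing N R] [DifferentialRing N S]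
    (hS : IsDifferentialExtension N R S) (a : Fin n → S) :
    IsDifferentialIdeal N (vanishingIdeal a : Ideal (DiffPoly N n R)) := by
  intro j f hf
  rw [mem_vanishingIdeal] at hf ⊢
  rw [eval_der hS, hf, map_zero]

/-- The generic zero of a prime differential ideal `P`. -/
theorem exists_generic_zero {N n : ℕ} {K : Type u} [Field K] [DifferentialRing N K]
    {P : Ideal (DiffPoly N n K)} (hprime : P.IsPrime) (hP : IsDifferentialIdeal N P) :
    ∃ (L : Type u) (_ : Field L) (_ : Algebra K L) (_ : DifferentialRing N L),
      IsDifferentialExtension N K L ∧ ∃ a : Fin n → L, ∀ f, eval a f = 0 ↔ f ∈ P := by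
  obtain ⟨inst, hL⟩ := hP.exists_differentialRing (L := FractionRing (DiffPoly N n K ⧸ P))
  let φ : DiffPoly N n K →ₐ[K] FractionRing (DiffPoly N n K ⧸ P) :=
    (IsScalarTower.toAlgHom K (DiffPoly N n K ⧸ P) _).comp (Ideal.Quotient.mkₐ K P)
  have hφ : ∀ j f, der j (φ f) = φ (der j f) := hL
  -- The classes of the underived variables. As `φ` commutes with derivations, evaluation at `a` is
  -- `φ` itself.
  let a : Fin n → FractionRing (DiffPoly N n K ⧸ P) := fun i => φ (MvPolynomial.X (i, 0))
  have htheta : ∀ (i : Fin n) (e : Fin N → ℕ), theta e (a i) = φ (MvPolynomial.X (i, e)) := by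
    intro i e
    induction e using Pi.induction_add_single with
    | zero => exact theta_zero _
    | add_single e j he => rw [theta_add_single, he, hφ, der_X]
  have heval : ∀ f, eval a f = φ f := by
    intro f
    refine DFunLike.congr_fun (MvPolynomial.algHom_ext (g := φ) fun x => ?_) f
    rw [MvPolynomial.aeval_X, htheta]
  refine ⟨_, inferInstance, inferInstance, inst, fun j c => ?_, a, fun f => ?_⟩
  · rw [← φ.commutes, ← φ.commutes, hφ, MvPolynomial.algebraMap_eq, der_C]
  · rw [heval]
    change algebraMap (DiffPoly N n K ⧸ P) _ (Ideal.Quotient.mk P f) = 0 ↔ _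
    rw [FaithfulSMul.algebraMap_eq_zero_iff, Ideal.Quotient.eq_zero_iff_mem]

end DiffPoly

/-! ### Dickson's lemma, the ranking of the variables, and leaders. -/

/-- Dickson's lemma for the variables of a differential polynomial ring. -/
theorem DiffPoly.exists_finset_dickson {N n : ℕ} (E : Set (Fin n × (Fin N → ℕ))) :
    ∃ B : Finset (Fin n × (Fin N → ℕ)), (∀ b ∈ B, b ∈ E) ∧
      ∀ v ∈ E, ∃ b ∈ B, ∃ e, v = (b.1, b.2 + e) := by
  let T : Fin n → Set (Fin N → ℕ) := fun i => {e | Minimal (fun e => (i, e) ∈ E) e}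
  have hT : ∀ i, (T i).Finite := fun i =>
    WellQuasiOrderedLE.finite_of_isAntichain (setOfPred_minimal_antichain _)
  have hfin : (⋃ i, Prod.mk i '' T i).Finite := Set.finite_iUnion fun i => (hT i).image _
  refine ⟨hfin.toFinset, fun b hb => ?_, fun v hv => ?_⟩
  · simp only [Set.Finite.mem_toFinset, Set.mem_iUnion, Set.mem_image] at hb
    obtain ⟨i, e, he, rfl⟩ := hb
    exact (show Minimal (fun e => (i, e) ∈ E) e from he).prop
  · obtain ⟨b, hb, hmin⟩ := (Set.isPWO_of_wellQuasiOrderedLE {e | (v.1, e) ∈ E}).exists_le_minimal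
      (show v.2 ∈ _ from hv)
    refine ⟨(v.1, b), ?_, v.2 - b, ?_⟩
    · simp only [Set.Finite.mem_toFinset, Set.mem_iUnion, Set.mem_image]
      exact ⟨v.1, b, hmin, rfl⟩
    · simp [add_tsub_cancel_of_le hb]

namespace DiffPoly

open DifferentialRing MvPolynomial

/-- An orderly well-ordering of the variables of a differential polynomial ring. -/
def rank {N n : ℕ} (x : Fin n × (Fin N → ℕ)) : Lex (Fin N → ℕ) ×ₗ Fin n :=
  toLex (toLex x.2, x.1)

theorem rank_injective {N n : ℕ} :
    Function.Injective (rank : Fin n × (Fin N → ℕ) → Lex (Fin N → ℕ) ×ₗ Fin n) := by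
  rintro ⟨i, e⟩ ⟨j, f⟩ h
  have h1 := congrArg ofLex h
  simp only [rank, ofLex_toLex, Prod.mk.injEq, toLex_inj] at h1
  exact Prod.ext h1.2 h1.1

theorem rank_lt_rank_iff {N n : ℕ} {v w : Fin n × (Fin N → ℕ)} :
    rank v < rank w ↔ toLex v.2 < toLex w.2 ∨ v.2 = w.2 ∧ v.1 < w.1 := by
  simp [rank, Prod.Lex.toLex_lt_toLex]

/-- With `rank_lt_rank_add`, these are the axioms of a ranking: derivation preserves the order of
variables and raises each of them. -/
theorem rank_add_lt_rank_add {N n : ℕ} {v w : Fin n × (Fin N → ℕ)} (h : rank v < rank w)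
    (e : Fin N → ℕ) : rank (v.1, v.2 + e) < rank (w.1, w.2 + e) := by
  rw [rank_lt_rank_iff] at h ⊢
  rcases h with h | ⟨h1, h2⟩
  · left
    simpa only [toLex_add] using add_lt_add_left h (toLex e)
  · right
    simp [h1, h2]

theorem rank_lt_rank_add {N n : ℕ} (v : Fin n × (Fin N → ℕ)) {e : Fin N → ℕ} (he : e ≠ 0) :
    rank v < rank (v.1, v.2 + e) := by
  rw [rank_lt_rank_iff]
  left
  exact Pi.toLex_strictMono (lt_add_of_pos_right _ (pos_iff_ne_zero.2 he))

/-- The differential polynomials all of whose variables are ranked lower than `v`. -/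
noncomputable abbrev lower {N n : ℕ} (K : Type u) [Field K] (v : Fin n × (Fin N → ℕ)) :
    Subalgebra K (DiffPoly N n K) :=
  supported K {w | rank w < rank v}

theorem lower_mono {N n : ℕ} {K : Type u} [Field K] {v w : Fin n × (Fin N → ℕ)}
    (h : rank v ≤ rank w) : lower K v ≤ lower K w :=
  supported_mono fun _ hx => lt_of_lt_of_le hx h

theorem X_mem_lower {N n : ℕ} {K : Type u} [Field K] {v w : Fin n × (Fin N → ℕ)}
    (h : rank w < rank v) : (X w : DiffPoly N n K) ∈ lower K v :=
  X_mem_supported.2 h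

theorem der_mem_lower {N n : ℕ} {K : Type u} [Field K] [DifferentialRing N K]
    {v : Fin n × (Fin N → ℕ)} {f : DiffPoly N n K} (hf : f ∈ lower K v) (j : Fin N) :
    der j f ∈ lower K (v.1, v.2 + Pi.single j 1) := by
  have hle : lower K v ≤ lower K (v.1, v.2 + Pi.single j 1) :=
    lower_mono (rank_lt_rank_add v (by simp)).le
  induction hf using Algebra.adjoin_induction with
  | mem x hx =>
    obtain ⟨w, hw, rfl⟩ := hx
    rw [der_X, X_mem_supported]
    exact rank_add_lt_rank_add hw _
  | algebraMap c =>
    rw [MvPolynomial.algebraMap_eq, der_C]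
    exact Subalgebra.algebraMap_mem _ _
  | add x y _ _ hx hy => rw [map_add]; exact add_mem hx hy
  | mul x y hx' hy' hx hy =>
    rw [Derivation.leibniz]
    exact add_mem (mul_mem (hle hx') hy) (mul_mem (hle hy') hx)

/-- A differential polynomial with leader at most `v` is a polynomial in `v` over the lower
variables. -/
theorem exists_aeval_eq {N n : ℕ} {K : Type u} [Field K] {v : Fin n × (Fin N → ℕ)}
    {f : DiffPoly N n K} (hf : f ∈ supported K {w | rank w ≤ rank v}) :
    ∃ p : Polynomial (lower K v), Polynomial.aeval (X v : DiffPoly N n K) p = f := by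
  induction hf using Algebra.adjoin_induction with
  | mem x hx =>
    obtain ⟨w, hw, rfl⟩ := hx
    rcases lt_or_eq_of_le (show rank w ≤ rank v from hw) with hlt | heq
    · refine ⟨Polynomial.C ⟨X w, X_mem_lower hlt⟩, ?_⟩
      rw [Polynomial.aeval_C]
      rfl
    · rw [rank_injective heq]
      exact ⟨Polynomial.X, Polynomial.aeval_X _⟩
  | algebraMap c =>
    refine ⟨Polynomial.C (algebraMap K _ c), ?_⟩
    rw [Polynomial.aeval_C]
    rfl
  | add x y _ _ hx hy =>
    obtain ⟨p, rfl⟩ := hx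
    obtain ⟨q, rfl⟩ := hy
    exact ⟨p + q, map_add _ _ _⟩
  | mul x y _ _ hx hy =>
    obtain ⟨p, rfl⟩ := hx
    obtain ⟨q, rfl⟩ := hy
    exact ⟨p * q, map_mul _ _ _⟩

theorem aeval_mem_lower {N n : ℕ} {K : Type u} [Field K] {v w : Fin n × (Fin N → ℕ)}
    (h : rank v < rank w) (p : Polynomial (lower K v)) :
    Polynomial.aeval (X v : DiffPoly N n K) p ∈ lower K w := by
  rw [Polynomial.aeval_eq_sum_range]
  refine sum_mem fun i _ => ?_
  rw [Subalgebra.smul_def, smul_eq_mul]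
  exact mul_mem (lower_mono h.le (p.coeff i).2) (pow_mem (X_mem_lower h) _)

/-- The derivative of a differential polynomial with leader `v` is linear in the derivative of `v`,
and its initial is the separant. -/
theorem exists_der_aeval {N n : ℕ} {K : Type u} [Field K] [DifferentialRing N K]
    (v : Fin n × (Fin N → ℕ)) (p : Polynomial (lower K v)) (j : Fin N) :
    ∃ g ∈ lower K (v.1, v.2 + Pi.single j 1),
      der j (Polynomial.aeval (X v : DiffPoly N n K) p) =
        Polynomial.aeval (X v : DiffPoly N n K) (Polynomial.derivative p) *
          X (v.1, v.2 + Pi.single j 1) + g := by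
  have hlt : rank v < rank (v.1, v.2 + Pi.single j 1) := rank_lt_rank_add v (by simp)
  induction p using Polynomial.induction_on' with
  | add p q hp hq =>
    obtain ⟨g, hg, hpg⟩ := hp
    obtain ⟨h, hh, hqh⟩ := hq
    refine ⟨g + h, add_mem hg hh, ?_⟩
    simp only [map_add, hpg, hqh]
    ring
  | monomial k c =>
    refine ⟨der j (c : DiffPoly N n K) * X v ^ k,
      mul_mem (der_mem_lower c.2 j) (pow_mem (X_mem_lower hlt) _), ?_⟩
    rw [Polynomial.derivative_monomial, Polynomial.aeval_monomial, Polynomial.aeval_monomial,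
      Derivation.leibniz, Derivation.leibniz_pow, der_X, map_mul, map_natCast]
    change (c : DiffPoly N n K) • _ + _ • der j (c : DiffPoly N n K) =
      (c : DiffPoly N n K) * _ * _ * _ + _
    simp only [smul_eq_mul, nsmul_eq_mul]
    ring

/-- All proper derivatives of a differential polynomial with leader `v` are linear in their leader,
and their initial is the separant. -/
theorem exists_linear_mem {N n : ℕ} {K : Type u} [Field K] [DifferentialRing N K]
    {J : Ideal (DiffPoly N n K)} (hJ : IsDifferentialIdeal N J)
    (v : Fin n × (Fin N → ℕ)) (p : Polynomial (lower K v))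
    (hp : Polynomial.aeval (X v : DiffPoly N n K) p ∈ J) (e : Fin N → ℕ) (he : e ≠ 0) :
    ∃ g ∈ lower K (v.1, v.2 + e),
      Polynomial.aeval (X v : DiffPoly N n K) (Polynomial.derivative p) *
          X (v.1, v.2 + e) + g ∈ J := by
  induction e using Pi.induction_add_single with
  | zero => exact absurd rfl he
  | add_single e j ih =>
    -- The first derivative is taken of `p`, which need not be linear in `v`; each later one is
    -- taken of a linear polynomial `s * X + g`, whose initial `s` persists.
    rcases eq_or_ne e 0 with rfl | he0
    · obtain ⟨g, hg, hpg⟩ := exists_der_aeval v p j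
      refine ⟨g, ?_, ?_⟩
      · rwa [zero_add]
      · rw [zero_add, ← hpg]
        exact hJ j _ hp
    · obtain ⟨g, hg, hpg⟩ := ih he0
      have hs := aeval_mem_lower (rank_lt_rank_add v he0) (Polynomial.derivative p)
      have hlt : rank (v.1, v.2 + e) < rank (v.1, v.2 + (e + Pi.single j 1)) := by
        rw [← add_assoc]
        exact rank_lt_rank_add (v.1, v.2 + e) (by simp)
      have hds := der_mem_lower hs j
      have hdg := der_mem_lower hg j
      simp only [add_assoc] at hds hdg
      refine ⟨X (v.1, v.2 + e) *
        der j (Polynomial.aeval (X v : DiffPoly N n K) (Polynomial.derivative p)) + der j g,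
        add_mem (mul_mem (X_mem_lower hlt) hds) hdg, ?_⟩
      have := hJ j _ hpg
      rw [map_add, Derivation.leibniz, der_X, smul_eq_mul, smul_eq_mul, add_assoc] at this
      rwa [add_assoc] at this

/-! ### Pseudo-division and the finite characteristic data. -/

/-- If every polynomial of `P` in the variable `v` whose initial is not in `P` is dominated by
a polynomial of `P ⊓ J` in `v` whose initial is not in `J`, then membership in `P` passes to `J`
from the lower variables to `v`. -/
theorem aeval_mem_of_pseudodivision {N n : ℕ} {K : Type u} [Field K] {P J : Ideal (DiffPoly N n K)}
    (hJ : J.IsPrime) (v : Fin n × (Fin N → ℕ))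
    (hlow : ∀ f ∈ lower K v, f ∈ P → f ∈ J)
    (hdiv : ∀ q : Polynomial (lower K v), Polynomial.aeval (X v : DiffPoly N n K) q ∈ P →
      (q.leadingCoeff : DiffPoly N n K) ∉ P → ∃ g : Polynomial (lower K v),
        Polynomial.aeval (X v : DiffPoly N n K) g ∈ P ⊓ J ∧
        (g.leadingCoeff : DiffPoly N n K) ∉ J ∧ g.degree ≤ q.degree)
    (q : Polynomial (lower K v)) (hq : Polynomial.aeval (X v : DiffPoly N n K) q ∈ P) :
    Polynomial.aeval (X v : DiffPoly N n K) q ∈ J := by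
  -- With `degree` rather than `natDegree`, erasing a nonzero constant still lowers the measure.
  induction hd : q.degree using WellFoundedLT.induction generalizing q with
  | ind d ih =>
    subst hd
    rcases eq_or_ne q 0 with rfl | hq0
    · simp
    by_cases hlc : (q.leadingCoeff : DiffPoly N n K) ∈ P
    · have haev : Polynomial.aeval (X v : DiffPoly N n K)
          (Polynomial.monomial q.natDegree q.leadingCoeff) =
          (q.leadingCoeff : DiffPoly N n K) * X v ^ q.natDegree :=
        Polynomial.aeval_monomial _
      have hsum : Polynomial.aeval (X v : DiffPoly N n K) q =
          Polynomial.aeval (X v : DiffPoly N n K) q.eraseLead +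
            (q.leadingCoeff : DiffPoly N n K) * X v ^ q.natDegree := by
        rw [← haev, ← map_add, Polynomial.eraseLead_add_monomial_natDegree_leadingCoeff]
      have hPe : Polynomial.aeval (X v : DiffPoly N n K) q.eraseLead ∈ P := by
        rw [hsum] at hq
        exact (Ideal.add_mem_iff_left P (P.mul_mem_right _ hlc)).1 hq
      rw [hsum]
      exact J.add_mem (ih _ (Polynomial.degree_eraseLead_lt hq0) _ hPe rfl)
        (J.mul_mem_right _ (hlow _ q.leadingCoeff.2 hlc))
    · obtain ⟨g, ⟨hgP, hgJ⟩, hglc, hgd⟩ := hdiv q hq hlc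
      have hg0 : g ≠ 0 := by
        rintro rfl
        simp at hglc
      have hnat : g.natDegree ≤ q.natDegree := Polynomial.natDegree_le_natDegree hgd
      have hgl0 : g.leadingCoeff ≠ 0 := Polynomial.leadingCoeff_ne_zero.2 hg0
      have hql0 : q.leadingCoeff ≠ 0 := Polynomial.leadingCoeff_ne_zero.2 hq0
      -- One step of pseudo-division: `lc(g) q - t g` has lower degree and stays in `P`. Once it is
      -- in `J`, primality cancels `lc(g) ∉ J`.
      let t : Polynomial (lower K v) :=
        Polynomial.monomial (q.natDegree - g.natDegree) q.leadingCoeff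
      have hlt : (Polynomial.C g.leadingCoeff * q - t * g).degree < q.degree := by
        have h1 : (Polynomial.C g.leadingCoeff * q).degree = q.degree :=
          Polynomial.degree_C_mul hgl0
        rw [← h1]
        refine Polynomial.degree_sub_lt_left ?_ (mul_ne_zero (Polynomial.C_ne_zero.2 hgl0) hq0) ?_
        · rw [h1, Polynomial.degree_mul, Polynomial.degree_monomial _ hql0,
            Polynomial.degree_eq_natDegree hg0, Polynomial.degree_eq_natDegree hq0]
          norm_cast
          omega
        · rw [Polynomial.leadingCoeff_mul, Polynomial.leadingCoeff_mul, Polynomial.leadingCoeff_C,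
            Polynomial.leadingCoeff_monomial, mul_comm]
      have hr := ih _ hlt (Polynomial.C g.leadingCoeff * q - t * g) (by
        rw [Polynomial.aeval_sub, map_mul, map_mul]
        exact P.sub_mem (P.mul_mem_left _ hq) (P.mul_mem_left _ hgP)) rfl
      rw [Polynomial.aeval_sub, map_mul, map_mul, Polynomial.aeval_C] at hr
      have h2 := (Submodule.sub_mem_iff_left J (J.mul_mem_left _ hgJ)).1 hr
      exact (hJ.mem_or_mem h2).resolve_left hglc

/-- A prime differential ideal in characteristic zero is determined by finitely many of its members
and finitely many non-members. -/
theorem exists_finset_characteristic {N n : ℕ} {K : Type u} [Field K] [CharZero K]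
    [DifferentialRing N K] {P : Ideal (DiffPoly N n K)} (hP : P.IsPrime)
    (hPd : IsDifferentialIdeal N P) :
    ∃ A H : Finset (DiffPoly N n K), (∀ f ∈ A, f ∈ P) ∧ (∀ h ∈ H, h ∉ P) ∧
      ∀ J : Ideal (DiffPoly N n K), J.IsPrime → IsDifferentialIdeal N J → (∀ f ∈ A, f ∈ J) →
        (∀ h ∈ H, h ∉ J) → P ≤ J := by
  classical
  let ev (v : Fin n × (Fin N → ℕ)) (p : Polynomial (lower K v)) : DiffPoly N n K :=
    Polynomial.aeval (X v : DiffPoly N n K) p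
  let T (v : Fin n × (Fin N → ℕ)) : Set (Polynomial (lower K v)) :=
    {p | ev v p ∈ P ∧ (p.leadingCoeff : DiffPoly N n K) ∉ P}
  have hmin : ∀ v, ∃ p : Polynomial (lower K v), (T v).Nonempty →
      p ∈ T v ∧ ∀ q ∈ T v, p.degree ≤ q.degree := by
    intro v
    by_cases hne : (T v).Nonempty
    · obtain ⟨p, hp, hle⟩ := WellFounded.has_min
        (InvImage.wf Polynomial.degree (wellFounded_lt (α := WithBot ℕ))) (T v) hne
      exact ⟨p, fun _ => ⟨hp, fun q hq => not_lt.1 (hle q hq)⟩⟩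
    · exact ⟨0, fun h => absurd h hne⟩
  choose p hp using hmin
  -- A constant is its own leading coefficient, which cannot be both in `P` and outside it.
  have hdeg : ∀ v, ∀ q ∈ T v, 0 < q.natDegree := by
    intro v q hq
    rw [Nat.pos_iff_ne_zero]
    intro h0
    have h1 := hq.1
    rw [Polynomial.eq_C_of_natDegree_eq_zero h0] at h1
    simp only [ev, Polynomial.aeval_C] at h1
    refine hq.2 ?_
    rw [Polynomial.leadingCoeff, h0]
    exact h1
  -- The separant has smaller degree, and its initial is that of `p v` times a positive integer, a
  -- unit in characteristic zero; membership in `P` would contradict minimality.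
  have hsep : ∀ v, (T v).Nonempty → ev v (Polynomial.derivative (p v)) ∉ P := by
    intro v hv hmem
    obtain ⟨hpT, hple⟩ := hp v hv
    have hpos := hdeg v _ hpT
    have hp0 : p v ≠ 0 := by
      intro h
      simp [h] at hpos
    refine absurd (hple _ ⟨hmem, ?_⟩) (not_le.2 (Polynomial.degree_derivative_lt hp0))
    rw [Polynomial.leadingCoeff_derivative]
    intro h
    have h1 : ((p v).leadingCoeff : DiffPoly N n K) * C ((p v).natDegree : K) ∈ P := by
      simpa using h
    refine (hP.mem_or_mem h1).elim hpT.2 fun h2 => hP.ne_top (P.eq_top_of_isUnit_mem h2 ?_)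
    exact (IsUnit.mk0 ((p v).natDegree : K) (Nat.cast_ne_zero.2 hpos.ne')).map C
  obtain ⟨B, hBE, hB⟩ := exists_finset_dickson {v | (T v).Nonempty}
  refine ⟨B.image fun b => ev b (p b),
    (B.image fun b => ((p b).leadingCoeff : DiffPoly N n K)) ∪
      B.image fun b => ev b (Polynomial.derivative (p b)), ?_, ?_, ?_⟩
  · simp only [Finset.mem_image]
    rintro _ ⟨b, hb, rfl⟩
    exact (hp b (hBE b hb)).1.1
  · simp only [Finset.mem_union, Finset.mem_image]
    rintro _ (⟨b, hb, rfl⟩ | ⟨b, hb, rfl⟩)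
    · exact (hp b (hBE b hb)).1.2
    · exact hsep b (hBE b hb)
  · intro J hJ hJd hAJ hHJ
    have hfJ : ∀ b ∈ B, ev b (p b) ∈ J := fun b hb => hAJ _ (Finset.mem_image_of_mem _ hb)
    have hlJ : ∀ b ∈ B, ((p b).leadingCoeff : DiffPoly N n K) ∉ J := fun b hb =>
      hHJ _ (Finset.mem_union_left _ (Finset.mem_image_of_mem _ hb))
    have hsJ : ∀ b ∈ B, ev b (Polynomial.derivative (p b)) ∉ J := fun b hb =>
      hHJ _ (Finset.mem_union_right _ (Finset.mem_image_of_mem _ hb))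
    -- Derivatives of the chosen polynomials must lie in `P`, to keep remainders in `P`, and in `J`,
    -- to carry membership back.
    have hPJd : IsDifferentialIdeal N (P ⊓ J) := fun j f hf => ⟨hPd j f hf.1, hJd j f hf.2⟩
    have hvars : ∀ f ∈ P, (∀ v ∈ f.vars, ∀ g ∈ P, g ∈ supported K {w | rank w ≤ rank v} → g ∈ J) →
        f ∈ J := by
      intro f hf hv
      rcases f.vars.eq_empty_or_nonempty with h0 | hne
      · obtain ⟨c, rfl⟩ : ∃ c, f = C c := ⟨_, vars_eq_empty_iff_eq_C.1 h0⟩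
        rcases eq_or_ne c 0 with rfl | hc
        · simp
        · exact absurd (P.eq_top_of_isUnit_mem hf ((IsUnit.mk0 c hc).map C)) hP.ne_top
      · obtain ⟨v, hvf, hmax⟩ := f.vars.exists_max_image rank hne
        exact hv v hvf f hf (mem_supported.2 fun w hw => hmax w hw)
    have hmain : ∀ v : Fin n × (Fin N → ℕ), ∀ g ∈ P,
        g ∈ supported K {w | rank w ≤ rank v} → g ∈ J := by
      intro v
      induction hr : rank v using WellFoundedLT.induction generalizing v with
      | ind r ih =>
        subst hr
        intro f hf hfv
        obtain ⟨q, rfl⟩ := exists_aeval_eq hfv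
        refine aeval_mem_of_pseudodivision hJ v (fun f hfl hfP => hvars f hfP fun w hw =>
          ih _ (mem_supported.1 hfl hw) w rfl) (fun q hq hqlc => ?_) q hf
        obtain ⟨b, hb, e, rfl⟩ := hB v ⟨q, hq, hqlc⟩
        rcases eq_or_ne e 0 with rfl | he
        · simp only [add_zero, Prod.mk.eta] at q hq hqlc ⊢
          exact ⟨p b, ⟨(hp b (hBE b hb)).1.1, hfJ b hb⟩, hlJ b hb,
            (hp b (hBE b hb)).2 q ⟨hq, hqlc⟩⟩
        -- Here the leader is a proper derivative of `b`: the divisor is a derivative of `p b`, of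
        -- degree one, with the separant as initial.
        · obtain ⟨g, hg, hgJ⟩ := exists_linear_mem hPJd b (p b)
            ⟨(hp b (hBE b hb)).1.1, hfJ b hb⟩ e he
          let s : lower K (b.1, b.2 + e) := ⟨ev b (Polynomial.derivative (p b)),
            aeval_mem_lower (rank_lt_rank_add b he) _⟩
          have hs0 : s ≠ 0 := by
            intro h
            refine hsJ b hb ?_
            rw [show ev b (Polynomial.derivative (p b)) = 0 from congrArg Subtype.val h]
            exact J.zero_mem
          refine ⟨Polynomial.C s * Polynomial.X + Polynomial.C ⟨g, hg⟩, ?_, ?_, ?_⟩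
          · rw [map_add, map_mul, Polynomial.aeval_C, Polynomial.aeval_C, Polynomial.aeval_X]
            exact hgJ
          · rw [Polynomial.leadingCoeff_linear hs0]
            exact hsJ b hb
          · rw [Polynomial.degree_linear hs0]
            have hpos := hdeg _ q ⟨hq, hqlc⟩
            exact Nat.WithBot.one_le_iff_zero_lt.2 (Polynomial.natDegree_pos_iff_degree_pos.1 hpos)
    exact fun f hf => hvars f hf fun v _ => hmain v

end DiffPoly

theorem corollary4p4 {N n : ℕ} {K : Type*} [Field K] [CharZero K] [DifferentialRing N K]
    (hK : IsDifferentiallyClosed N K) (I : Ideal (DiffPoly N n K))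
    (hI : IsDifferentialIdeal N I) (hproper : I ≠ ⊤) :
    ∃ a : Fin n → K, ∀ f ∈ I, DiffPoly.eval a f = 0 := by
  obtain ⟨P, hIP, hP, hPd⟩ := hI.exists_le_isPrime hproper
  obtain ⟨A, H, hA, hH, hAH⟩ := DiffPoly.exists_finset_characteristic hP hPd
  obtain ⟨L, _, _, _, hL, a, ha⟩ := DiffPoly.exists_generic_zero hP hPd
  obtain ⟨b, hbA, hbH⟩ := hK n A H ⟨L, _, _, _, hL, a, fun f hf => (ha f).2 (hA f hf),
    fun h hh => fun h0 => hH h hh ((ha h).1 h0)⟩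
  refine ⟨b, fun f hf => DiffPoly.mem_vanishingIdeal.1 ?_⟩
  exact hAH _ (DiffPoly.vanishingIdeal_isPrime b)
    (DiffPoly.isDifferentialIdeal_vanishingIdeal (fun _ _ => rfl) b)
    (fun f hf => DiffPoly.mem_vanishingIdeal.2 (hbA f hf))
    (fun h hh h0 => hbH h hh (DiffPoly.mem_vanishingIdeal.1 h0)) (hIP hf)
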